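/- Let $\Sigma$ be a set of primes, let $\mathcal{F}$ be a free pro-$\Sigma$ group, and let $X\subset\mathcal{F}$ be a set of free generators of $\mathcal{F}$ (a basis converging to $1$: every neighbourhood of $1$ contains all but finitely many elements of $X$, $X$ generates $\mathcal{F}$ topologically, and every map from $X$ to a pro-$\Sigma$ group that converges to $1$ extends uniquely to a continuous homomorphism on $\mathcal{F}$). Put $\mathcal{F}^{[0]}:=\mathcal{F}$, let $\mathcal{F}^{[i]}:=\overline{[\mathcal{F}^{[i-1]},\mathcal{F}^{[i-1]}]}$ be the closure of the commutator subgroup of $\mathcal{F}^{[i-1]}$ for $i\geq 1$, and let $\mathcal{F}^{m}:=\mathcal{F}/\mathcal{F}^{[m]}$ with the quotient topology. Let $m\geq 2$ be an integer. Then for every $x\in X$ and every $n\in\mathbb{Z}\setminus\{0\}$, the centralizer in $\mathcal{F}^{m}$ of the image of $x^{n}$ is the closure in $\mathcal{F}^m$ of the subgroup generated by the image of $x$: $$Z_{\mathcal{F}^{m}}(x^{n})=\overline{\langle x\rangle}.$$ In particular, $\mathcal{F}^{m}$ is abelian or has trivial center. -/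

import Mathlib

open Filter Topology

universe u

/-- `G` is a pro-`S` group: a profinite group all of whose finite continuous quotients have order
divisible only by primes in `S`. -/
structure IsProSGroup (S : Set Nat.Primes) (G : Type*) [Group G] [TopologicalSpace G] : Prop where
  isTopologicalGroup : IsTopologicalGroup G
  compactSpace : CompactSpace G
  t2Space : T2Space G
  totallyDisconnectedSpace : TotallyDisconnectedSpace G
  mem_of_dvd_index : ∀ N : Subgroup G, N.Normal → IsOpen (N : Set G) →
    ∀ p : Nat.Primes, (p : ℕ) ∣ N.index → p ∈ S

/-- `F` is a free pro-`S` group and `X ⊆ F` is a set of free generators of `F`, i.e. a basis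
converging to `1`: every neighbourhood of `1` contains all but finitely many elements of `X`,
`X` generates `F` topologically, and every map from `X` to a pro-`S` group that converges to `1`
extends uniquely to a continuous homomorphism on `F`. -/
structure IsFreeProSGroupOn (S : Set Nat.Primes) (F : Type u) [Group F] [TopologicalSpace F]
    (X : Set F) : Prop where
  isProSGroup : IsProSGroup S F
  tendsto_one : Tendsto (fun x : X => (x : F)) cofinite (𝓝 1)
  dense_closure : Dense (Subgroup.closure X : Set F)
  existsUnique_extension : ∀ (G : Type u) [Group G] [TopologicalSpace G], IsProSGroup S G →
    ∀ f : X → G, Tendsto f cofinite (𝓝 1) →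
      ∃! φ : F →ₜ* G, ∀ x : X, φ (x : F) = f x

section ClosedDerivedSeries

variable (G : Type*) [Group G] [TopologicalSpace G] [IsTopologicalGroup G]

/-- The topological derived series: `G^[0] = G`, and `G^[m+1]` is the closure of the commutator
subgroup of `G^[m]`. -/
def closedDerivedSeries : ℕ → Subgroup G
  | 0 => ⊤
  | m + 1 => ⁅closedDerivedSeries m, closedDerivedSeries m⁆.topologicalClosure

instance closedDerivedSeries_normal (m : ℕ) : (closedDerivedSeries G m).Normal := by
  induction m with
  | zero => exact inferInstanceAs ((⊤ : Subgroup G).Normal)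
  | succ m ih => exact Subgroup.is_normal_topologicalClosure _

/-- The maximal `m`-step solvable quotient `G^m = G / G^[m]`, with the quotient topology. -/
abbrev MStepSolvableQuotient (m : ℕ) : Type _ := G ⧸ closedDerivedSeries G m

end ClosedDerivedSeries

/-! By freeness, prescribing values on `X`, almost all trivial, defines a map to any finite
`S`-group. The targets are wreath products with abelian base: if the quotient coordinate kills
`F^[k]`, the whole map kills `F^[k+1]`.

`mk_mem_zpowers_of_commutator_mem`: give `x` a base entry `t` with `t ^ n ≠ 1`. The base of `x ^ n`
then has nontrivial product over `⟨x⟩`, so commuting with it forces the quotient coordinate into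
`⟨x⟩`.

`mem_closedDerivedSeries_of_commutator_mem`: a map `φ` to `D ≀ᵣ Q` detecting `g` lifts to `D ≀ᵣ (Q ×
C)`, with `x` of large order in the cyclic group `C`. A base element commuting with a suitable power
of `x` is constant on orbits of length divisible by `|D|`, so its product along `C`, which is `φ g`,
is trivial.

Compactness turns the first fact into `g = z * h` with `z` in the closure of `⟨x⟩` and `h` in
`F^[k+1]`. As `z` commutes with `x ^ n`, the second fact applies to `h`. A central element lies in
the closed subgroup of every generator, and two of these meet trivially. -/

/-! ### Wreath products and products over cyclic orbits -/

section WreathProducts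

/-- The Kaloujnine–Krasner construction: a homomorphism from a normal subgroup `K` of `G` to an
abelian group `D` induces a homomorphism from `G` to the wreath product of `D` and `G ⧸ K`. -/
theorem exists_hom_regularWreathProduct {G D : Type*} [Group G] [CommGroup D] (K : Subgroup G)
    [K.Normal] (θ : K →* D) :
    ∃ φ : G →* D ≀ᵣ (G ⧸ K), (∀ g, (φ g).right = g) ∧ (∀ k : K, φ k = 1 → θ k = 1) ∧
      ∀ N : Subgroup G, N.Normal → N ≤ K → (∀ k : K, (k : G) ∈ N → θ k = 1) → N ≤ φ.ker := by
  let s : G ⧸ K → G := Quotient.out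
  have hs : ∀ q, (s q : G ⧸ K) = q := fun q => Quotient.out_eq q
  have hmem : ∀ (g : G) (q : G ⧸ K), (s q)⁻¹ * g * s ((g : G ⧸ K)⁻¹ * q) ∈ K := fun g q => by
    rw [← QuotientGroup.eq_one_iff]
    rw [QuotientGroup.mk_mul, QuotientGroup.mk_mul, QuotientGroup.mk_inv, hs, hs]
    group
  let φ : G →* D ≀ᵣ (G ⧸ K) := MonoidHom.mk' (fun g => ⟨fun q => θ ⟨_, hmem g q⟩, g⟩) <| by
    intro g h
    ext q
    · change θ _ = θ _ * θ _
      rw [← map_mul]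
      congr 1
      apply Subtype.ext
      change _ * (g * h) * s _ = _ * g * s _ * (_ * h * s _)
      rw [show ((g * h : G) : G ⧸ K)⁻¹ * q = (h : G ⧸ K)⁻¹ * ((g : G ⧸ K)⁻¹ * q) by
        rw [QuotientGroup.mk_mul]; group]
      group
    · rfl
  refine ⟨φ, fun g => rfl, fun k hk => ?_, fun N hN hNK hθ g hg => ?_⟩
  -- The coordinate at `1` is `θ` of a conjugate of `k` by an element of `K`, which is `θ k` since
  -- `D` is abelian.
  · have h1 : θ ⟨_, hmem k 1⟩ = 1 := congrFun (congrArg RegularWreathProduct.left hk) 1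
    have hk1 : ((k : G) : G ⧸ K) = 1 := (QuotientGroup.eq_one_iff _).2 k.2
    have hs1 : s 1 ∈ K := (QuotientGroup.eq_one_iff _).1 (hs 1)
    have h2 : (⟨_, hmem k 1⟩ : K) = ⟨s 1, hs1⟩⁻¹ * k * ⟨s 1, hs1⟩ := by
      apply Subtype.ext
      simp [hk1]
    rw [h2, map_mul, map_mul, map_inv, mul_comm (θ _)⁻¹, inv_mul_cancel_right] at h1
    exact h1
  · have hg1 : (g : G ⧸ K) = 1 := (QuotientGroup.eq_one_iff _).2 (hNK hg)
    rw [MonoidHom.mem_ker]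
    ext q
    · refine hθ ⟨_, hmem g q⟩ ?_
      simpa [hg1] using hN.conj_mem g hg (s q)⁻¹
    · exact hg1

/-- Multiplication along the second factor of the base `Q × C`, as a homomorphism of wreath
products. -/
def RegularWreathProduct.prodSnd (D Q C : Type*) [CommGroup D] [Group Q] [Group C] [Fintype C] :
    D ≀ᵣ (Q × C) →* D ≀ᵣ Q :=
  MonoidHom.mk' (fun w => ⟨fun q => ∏ c, w.left (q, c), w.right.1⟩) <| by
    intro v w
    ext q
    · simp only [RegularWreathProduct.mul_left, Pi.mul_apply, Finset.prod_mul_distrib]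
      congr 1
      exact Fintype.prod_equiv (Equiv.mulLeft v.right.2⁻¹) _ _ fun c => rfl
    · rfl

theorem RegularWreathProduct.prodSnd_right {D Q C : Type*} [CommGroup D] [Group Q] [Group C]
    [Fintype C] (w : D ≀ᵣ (Q × C)) : (prodSnd D Q C w).right = w.right.1 := rfl

/-- The product of a function on a finite group which is invariant under translation by an element
of order divisible by the order of the values is trivial. -/
theorem prod_eq_one_of_invariant {C D : Type*} [CommGroup C] [Fintype C] [CommGroup D]
    (f : C → D) (z : C) (hf : ∀ c, f (z * c) = f c) (hz : ∀ d : D, d ^ orderOf z = 1) :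
    ∏ c, f c = 1 := by
  classical
  let T : Subgroup C :=
    { carrier := {h | ∀ c, f (h * c) = f c}
      one_mem' := fun c => by rw [one_mul]
      mul_mem' := fun {a b} ha hb c => by rw [mul_assoc, ha, hb]
      inv_mem' := fun {a} ha c => by rw [← ha, mul_inv_cancel_left] }
  let H := Subgroup.zpowers z
  have hinv : ∀ h : H, ∀ c, f (c * h) = f c := fun h c => by
    rw [mul_comm]
    exact (Subgroup.zpowers_le.2 (show z ∈ T from hf)) h.2 c
  have hbij : Function.Bijective fun p : (C ⧸ H) × H => p.1.out * (p.2 : C) := by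
    refine ⟨fun p q hpq => ?_, fun c => ⟨((c : C ⧸ H), ⟨(c : C ⧸ H).out⁻¹ * c, ?_⟩), ?_⟩⟩
    · have h1 : p.1 = q.1 := by
        have := congrArg (QuotientGroup.mk : C → C ⧸ H) hpq
        simpa [QuotientGroup.mk_mul_of_mem] using this
      have h2 : p.2 = q.2 := by
        apply Subtype.ext
        simpa [h1] using hpq
      exact Prod.ext h1 h2
    · rw [← QuotientGroup.eq, QuotientGroup.out_eq']
    · simp
  rw [← Fintype.prod_bijective _ hbij (fun p => f (p.1.out * (p.2 : C))) f fun p => rfl,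
    Fintype.prod_prod_type]
  refine Finset.prod_eq_one fun q _ => ?_
  simp only [hinv]
  rw [Finset.prod_const, Finset.card_univ, Fintype.card_zpowers, hz]

/-- Passing to `t ^ N` divides the order by a gcd with `N`. Each prime has exponent less than `N` in
`N`, so at least one full factor `e` survives. -/
theorem dvd_orderOf_pow {C : Type*} [Group C] (t : C) {e N : ℕ} (he : e ≠ 0) (hN : N ≠ 0)
    (ht : orderOf t = e ^ (N + 1)) : e ∣ orderOf (t ^ N) := by
  rw [orderOf_pow' t hN, ht]
  have h : (e ^ (N + 1)).gcd N ∣ e ^ N := by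
    have hd := Nat.gcd_pos_of_pos_right (e ^ (N + 1)) (Nat.pos_of_ne_zero hN)
    rw [← Nat.factorization_prime_le_iff_dvd hd.ne' (pow_ne_zero _ he)]
    intro p hp
    by_cases hpd : p ∣ (e ^ (N + 1)).gcd N
    · have hpe := hp.dvd_of_dvd_pow (hpd.trans (Nat.gcd_dvd_left _ _))
      calc _ ≤ N.factorization p :=
            (Nat.factorization_le_iff_dvd hd.ne' hN).2 (Nat.gcd_dvd_right _ _) p
        _ ≤ N * 1 := by rw [mul_one]; exact (Nat.factorization_lt p hN).le
        _ ≤ N * e.factorization p := Nat.mul_le_mul_left _ (hp.factorization_pos_of_dvd he hpe)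
        _ = _ := by simp
    · rw [Nat.factorization_eq_zero_of_not_dvd hpd]
      exact Nat.zero_le _
  obtain ⟨d, hd⟩ := h
  refine ⟨d, ?_⟩
  apply Nat.div_eq_of_eq_mul_right (Nat.gcd_pos_of_pos_right _ (Nat.pos_of_ne_zero hN))
  rw [mul_comm e d, ← mul_assoc, ← hd, pow_succ]

end WreathProducts

universe v

/-! ### Closed derived series and separation by finite quotients -/

section ClosedDerivedSeries

variable {G : Type*} [Group G] [TopologicalSpace G] [IsTopologicalGroup G]

theorem isClosed_closedDerivedSeries (m : ℕ) : IsClosed (closedDerivedSeries G m : Set G) := by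
  cases m with
  | zero => exact isClosed_univ
  | succ m => exact Subgroup.isClosed_topologicalClosure _

theorem closedDerivedSeries_antitone : Antitone (closedDerivedSeries G) :=
  antitone_nat_of_succ_le fun m =>
    Subgroup.topologicalClosure_minimal _ (Subgroup.commutator_le_left _ _)
      (isClosed_closedDerivedSeries m)

theorem isClosed_ker_of_isOpen {W : Type*} [Group W] {φ : G →* W} (hφ : IsOpen (φ.ker : Set G)) :
    IsClosed (φ.ker : Set G) :=
  Subgroup.isClosed_of_isOpen _ hφ

theorem closedDerivedSeries_succ_le_ker {W : Type*} [Group W] {φ : G →* W}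
    (hφ : IsOpen (φ.ker : Set G)) (k : ℕ)
    (hc : ∀ a ∈ closedDerivedSeries G k, ∀ b ∈ closedDerivedSeries G k, φ a * φ b = φ b * φ a) :
    closedDerivedSeries G (k + 1) ≤ φ.ker := by
  refine Subgroup.topologicalClosure_minimal _ ?_ (isClosed_ker_of_isOpen hφ)
  rw [Subgroup.commutator_le]
  intro a ha b hb
  rw [MonoidHom.mem_ker, map_commutatorElement, commutatorElement_eq_one_iff_mul_comm]
  exact hc a ha b hb

theorem map_closedDerivedSeries_le (φ : G →* G) (hφ : Continuous φ) (m : ℕ) :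
    closedDerivedSeries G m ≤ (closedDerivedSeries G m).comap φ := by
  induction m with
  | zero => exact fun _ _ => Subgroup.mem_top _
  | succ m ih =>
    refine Subgroup.topologicalClosure_minimal _ ?_
      ((isClosed_closedDerivedSeries (m + 1)).preimage hφ)
    rw [Subgroup.commutator_le]
    intro a ha b hb
    rw [Subgroup.mem_comap, map_commutatorElement]
    exact Subgroup.le_topologicalClosure _ (Subgroup.commutator_mem_commutator (ih ha) (ih hb))

end ClosedDerivedSeries

section Profinite

/-- A closed subset of a profinite group is determined by its images in the finite quotients. -/
theorem IsClosed.mem_of_forall_openNormal {G : Type*} [Group G] [TopologicalSpace G]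
    [IsTopologicalGroup G] [CompactSpace G] [TotallyDisconnectedSpace G] {Z : Set G}
    (hZ : IsClosed Z) {g : G}
    (h : ∀ N : Subgroup G, N.Normal → IsOpen (N : Set G) → ∃ z ∈ Z, z⁻¹ * g ∈ N) : g ∈ Z := by
  by_contra hg
  obtain ⟨N, hN⟩ := ProfiniteGrp.exist_openNormalSubgroup_sub_open_nhds_of_one
    (U := (fun u => g * u⁻¹) ⁻¹' Zᶜ) (hZ.isOpen_compl.preimage (by fun_prop)) (by simpa using hg)
  obtain ⟨z, hz, hzg⟩ := h N.toSubgroup inferInstance N.isOpen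
  exact hN hzg (by simpa using hz)

end Profinite

/-! ### Homomorphisms from a free pro-`S` group to finite groups -/

namespace IsFreeProSGroupOn

variable {S : Set Nat.Primes} {F : Type u} [Group F] [TopologicalSpace F] {X : Set F}

theorem eq_top_of_isClosed (hX : IsFreeProSGroupOn S F X) {H : Subgroup F}
    (hH : IsClosed (H : Set F)) (hXH : X ⊆ H) : H = ⊤ := by
  rw [eq_top_iff]
  intro g _
  have h1 : closure (Subgroup.closure X : Set F) ⊆ H :=
    closure_minimal ((Subgroup.closure_le H).2 hXH) hH
  exact h1 (hX.dense_closure g)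

theorem finite_quotient [IsTopologicalGroup F] (hX : IsFreeProSGroupOn S F X) {N : Subgroup F}
    (hN : IsOpen (N : Set F)) : Finite (F ⧸ N) :=
  have := hX.isProSGroup.compactSpace
  Subgroup.quotient_finite_of_isOpen N hN

theorem finite_setOf_notMem (hX : IsFreeProSGroupOn S F X) {N : Subgroup F}
    (hN : IsOpen (N : Set F)) : {x : X | (x : F) ∉ N}.Finite :=
  hX.tendsto_one (hN.mem_nhds N.one_mem)

theorem hom_ext [IsTopologicalGroup F] (hX : IsFreeProSGroupOn S F X) {W : Type*} [Group W]
    {φ ψ : F →* W} (hφ : IsOpen (φ.ker : Set F)) (hψ : IsOpen (ψ.ker : Set F))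
    (h : ∀ x : X, φ x = ψ x) : φ = ψ := by
  have hop : IsOpen (φ.eqLocus ψ : Set F) := by
    refine Subgroup.isOpen_mono (H₁ := φ.ker ⊓ ψ.ker) (fun g hg => ?_) (hφ.inter hψ)
    exact (MonoidHom.mem_ker.1 hg.1).trans (MonoidHom.mem_ker.1 hg.2).symm
  have htop := hX.eq_top_of_isClosed (Subgroup.isClosed_of_isOpen _ hop)
    fun x hx => h ⟨x, hx⟩
  ext g
  exact (htop ▸ Subgroup.mem_top g : g ∈ φ.eqLocus ψ)

/-- The freeness of `F`, for finite groups in any universe. -/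
theorem exists_hom_finite (hX : IsFreeProSGroupOn S F X) {W : Type v} [Group W] [Finite W]
    (hW : ∀ p : Nat.Primes, (p : ℕ) ∣ Nat.card W → p ∈ S) (f : X → W)
    (hf : {x | f x ≠ 1}.Finite) :
    ∃ φ : F →* W, IsOpen (φ.ker : Set F) ∧ ∀ x : X, φ x = f x := by
  -- The universal property only concerns groups in universe `u`, so `W` is replaced by a discrete
  -- copy there.
  let _ : TopologicalSpace (Shrink.{u} W) := ⊥
  have : DiscreteTopology (Shrink.{u} W) := ⟨rfl⟩
  have : Finite (Shrink.{u} W) := Finite.of_equiv _ (equivShrink.{u} W)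
  let e : Shrink.{u} W ≃* W := Shrink.mulEquiv.{u}
  have hpro : IsProSGroup S (Shrink.{u} W) :=
    { isTopologicalGroup := inferInstance
      compactSpace := inferInstance
      t2Space := inferInstance
      totallyDisconnectedSpace := inferInstance
      mem_of_dvd_index := fun N _ _ p hp => hW p <| by
        rw [← Nat.card_congr e.toEquiv]
        exact hp.trans N.index_dvd_card }
  obtain ⟨φ, hφ, -⟩ := hX.existsUnique_extension _ hpro (fun x => e.symm (f x)) <| by
    rw [nhds_discrete, tendsto_pure, eventually_cofinite]
    refine hf.subset fun x hx h1 => hx ?_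
    rw [h1, map_one]
  refine ⟨e.toMonoidHom.comp φ.toMonoidHom, ?_, fun x => ?_⟩
  · have : (((e.toMonoidHom.comp φ.toMonoidHom).ker : Subgroup F) : Set F) = φ ⁻¹' {1} := by
      ext g
      simp [MonoidHom.mem_ker]
    rw [this]
    exact (isOpen_discrete _).preimage φ.continuous_toFun
  · change e (φ x) = f x
    rw [hφ, MulEquiv.apply_symm_apply]

end IsFreeProSGroupOn

/-! ### Commutation in wreath products -/

namespace RegularWreathProduct

variable {D Q C : Type*} [CommGroup D] [Group Q]

theorem mul_comm_of_right_eq_one {v w : D ≀ᵣ Q} (hv : v.right = 1) (hw : w.right = 1) :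
    v * w = w * v := by
  ext q
  · simp [hv, hw, mul_comm]
  · simp [hv, hw]

theorem mulSingle_pow [DecidableEq Q] [Finite Q] (x : Q) [Fintype (Subgroup.zpowers x)] (t : D)
    (i : ℕ) :
    ((⟨Pi.mulSingle 1 t, x⟩ : D ≀ᵣ Q) ^ i).right = x ^ i ∧
      (∀ q ∉ Subgroup.zpowers x, ((⟨Pi.mulSingle 1 t, x⟩ : D ≀ᵣ Q) ^ i).left q = 1) ∧
      ∏ h : Subgroup.zpowers x, ((⟨Pi.mulSingle 1 t, x⟩ : D ≀ᵣ Q) ^ i).left h = t ^ i := by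
  induction i with
  | zero => simp
  | succ i ih =>
    obtain ⟨h1, h2, h3⟩ := ih
    simp only [pow_succ' (_ : D ≀ᵣ Q), mul_right, mul_left, Pi.mul_apply, h1]
    refine ⟨(pow_succ' x i).symm, fun q hq => ?_, ?_⟩
    · rw [h2, mul_one, Pi.mulSingle_eq_of_ne]
      · rintro rfl
        exact hq (one_mem _)
      · rwa [Subgroup.mul_mem_cancel_left _ (inv_mem (Subgroup.mem_zpowers x))]
    · rw [Finset.prod_mul_distrib, pow_succ', ← h3]
      congr 1
      · rw [Fintype.prod_eq_single (1 : Subgroup.zpowers x)]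
        · simp
        · intro h hh
          exact Pi.mulSingle_eq_of_ne (fun h' => hh (Subtype.ext h')) _
      · exact Fintype.prod_equiv
          (Equiv.mulLeft (⟨x, Subgroup.mem_zpowers x⟩ : Subgroup.zpowers x)⁻¹) _ _ fun h => rfl

/-- If `v.right` were outside `⟨x⟩`, its translate of the base of the power would be trivial on
`⟨x⟩`. Multiplying the commutation relation over `⟨x⟩` cancels `v.left` and leaves `t ^ n = 1`. -/
theorem right_mem_zpowers_of_commute [DecidableEq Q] [Finite Q] {x : Q} {t : D} {n : ℕ}
    (ht : t ^ n ≠ 1) {v : D ≀ᵣ Q} (hv : Commute v ((⟨Pi.mulSingle 1 t, x⟩ : D ≀ᵣ Q) ^ n)) :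
    v.right ∈ Subgroup.zpowers x := by
  have : Fintype (Subgroup.zpowers x) := Fintype.ofFinite _
  obtain ⟨h1, h2, h3⟩ := mulSingle_pow x t n
  by_contra hr
  apply ht
  have key : ∀ h : Subgroup.zpowers x, v.left h =
      ((⟨Pi.mulSingle 1 t, x⟩ : D ≀ᵣ Q) ^ n).left h * v.left ((x ^ n)⁻¹ * h) := by
    intro h
    have := congrFun (congrArg left hv.eq) h
    simp only [mul_left, Pi.mul_apply, h1] at this
    rwa [h2 (v.right⁻¹ * h), mul_one] at this
    rwa [Subgroup.mul_mem_cancel_right _ h.2, inv_mem_iff]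
  have hprod := Finset.prod_congr (rfl : (Finset.univ : Finset (Subgroup.zpowers x)) = _)
    fun h _ => key h
  rw [Finset.prod_mul_distrib, h3] at hprod
  rw [Fintype.prod_equiv
    (Equiv.mulLeft (⟨x ^ n, Subgroup.npow_mem_zpowers x n⟩ : Subgroup.zpowers x)⁻¹)
    (fun h => v.left ((x ^ n)⁻¹ * h)) (fun h => v.left h) fun h => rfl] at hprod
  exact right_eq_mul.1 hprod

theorem prodSnd_eq_one_of_commute [CommGroup C] [Fintype C] {v w : D ≀ᵣ (Q × C)}
    (hv : v.right = 1) (hvw : Commute v w) {z : C} (hw : w.right = (1, z))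
    (hz : ∀ d : D, d ^ orderOf z = 1) : prodSnd D Q C v = 1 := by
  ext q
  · refine prod_eq_one_of_invariant (fun c => v.left (q, c)) z (fun c => ?_) hz
    have := congrFun (congrArg left hvw.eq) (q, z * c)
    simp only [mul_left, Pi.mul_apply, hv, hw, inv_one, one_mul] at this
    rw [mul_comm] at this
    simpa using mul_left_cancel this
  · simp [prodSnd_right, hv]

end RegularWreathProduct

open scoped commutatorElement

theorem MonoidHom.isOpen_ker_comp {G V W : Type*} [Group G] [TopologicalSpace G]
    [IsTopologicalGroup G] [Group V] [Group W] {φ : G →* V} (hφ : IsOpen (φ.ker : Set G))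
    (ψ : V →* W) : IsOpen ((ψ.comp φ).ker : Set G) :=
  Subgroup.isOpen_mono (H₁ := φ.ker) (fun g hg => by
    rw [MonoidHom.mem_ker, MonoidHom.comp_apply, MonoidHom.mem_ker.1 hg, map_one]) hφ

theorem MonoidHom.commute_of_commutator_mem {G W : Type*} [Group G] [Group W] {φ : G →* W}
    {H : Subgroup G} (hH : H ≤ φ.ker) {g y : G} (h : ⁅g, y⁆ ∈ H) : Commute (φ g) (φ y) := by
  have := hH h
  rwa [MonoidHom.mem_ker, map_commutatorElement, commutatorElement_eq_one_iff_commute] at this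

/-! ### The two commutator criteria -/

namespace IsFreeProSGroupOn

variable {S : Set Nat.Primes} {F : Type u} [Group F] [TopologicalSpace F] [IsTopologicalGroup F]
  {X : Set F}

/-- If `g` commutes with a nontrivial power of the free generator `x` modulo a term of the derived
series, then `g` lies in the closed subgroup generated by `x` modulo the preceding term. -/
theorem mk_mem_zpowers_of_commutator_mem (hX : IsFreeProSGroupOn S F X) (k : ℕ) {K : Subgroup F}
    [K.Normal] (hKo : IsOpen (K : Set F)) (hK : closedDerivedSeries F k ≤ K) {x : F} (hx : x ∈ X)
    {n : ℕ} (hn : n ≠ 0) {g : F} (hg : ⁅g, x ^ n⁆ ∈ closedDerivedSeries F (k + 1)) :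
    (g : F ⧸ K) ∈ Subgroup.zpowers (x : F ⧸ K) := by
  classical
  have := hX.finite_quotient hKo
  by_cases hQ : Nat.card (F ⧸ K) = 1
  · have := (Nat.card_eq_one_iff_unique.1 hQ).1
    rw [Subsingleton.elim (g : F ⧸ K) 1]
    exact one_mem _
  obtain ⟨p, hp, hpQ⟩ := Nat.exists_prime_and_dvd hQ
  have hS : ∀ r : Nat.Primes, (r : ℕ) ∣ Nat.card (F ⧸ K) → r ∈ S :=
    hX.isProSGroup.mem_of_dvd_index K inferInstance hKo
  have : NeZero (p ^ n) := ⟨pow_ne_zero _ hp.ne_zero⟩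
  let D := Multiplicative (ZMod (p ^ n))
  have hD : Nat.card D = p ^ n := Nat.card_zmod _
  let t : D := Multiplicative.ofAdd 1
  have ht : t ^ n ≠ 1 := by
    intro h
    have h1 : (n : ZMod (p ^ n)) = 0 := by
      rw [← nsmul_one]
      exact congrArg Multiplicative.toAdd h
    rw [ZMod.natCast_eq_zero_iff] at h1
    exact absurd (Nat.le_of_dvd (Nat.pos_of_ne_zero hn) h1)
      (not_le.2 (Nat.lt_pow_self hp.one_lt))
  let f : X → D ≀ᵣ (F ⧸ K) := fun y => ⟨if (y : F) = x then Pi.mulSingle 1 t else 1, (y : F)⟩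
  obtain ⟨ψ, hψo, hψ⟩ := hX.exists_hom_finite (W := D ≀ᵣ (F ⧸ K)) (fun r hr => by
    rw [RegularWreathProduct.card, hD, r.2.dvd_mul] at hr
    rcases hr with hr | hr
    · have h1 := (Nat.prime_dvd_prime_iff_eq r.2 hp).1
        (r.2.dvd_of_dvd_pow (r.2.dvd_of_dvd_pow hr))
      exact hS r (h1 ▸ hpQ)
    · exact hS r hr) f (by
    refine ((hX.finite_setOf_notMem hKo).union (Set.finite_singleton ⟨x, hx⟩)).subset ?_
    intro y hy
    by_contra hy'
    simp only [Set.mem_union, Set.mem_ofPred_eq, Set.mem_singleton_iff, not_or, not_not] at hy'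
    have h2 : (y : F) ≠ x := fun h => hy'.2 (Subtype.ext h)
    apply hy
    ext q
    · simp [f, h2]
    · exact (QuotientGroup.eq_one_iff _).2 hy'.1)
  have hright : ∀ a : F, (ψ a).right = a := fun a =>
    DFunLike.congr_fun (hX.hom_ext (φ := RegularWreathProduct.rightHom.comp ψ)
      (ψ := QuotientGroup.mk' K) (MonoidHom.isOpen_ker_comp hψo _) (by rwa [QuotientGroup.ker_mk'])
      fun y => by
        rw [MonoidHom.comp_apply, hψ]
        rfl) a
  have hker : closedDerivedSeries F (k + 1) ≤ ψ.ker :=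
    closedDerivedSeries_succ_le_ker hψo k fun a ha b hb =>
      RegularWreathProduct.mul_comm_of_right_eq_one
        ((hright a).trans ((QuotientGroup.eq_one_iff a).2 (hK ha)))
        ((hright b).trans ((QuotientGroup.eq_one_iff b).2 (hK hb)))
  have hcomm := MonoidHom.commute_of_commutator_mem hker hg
  rw [map_pow, hψ ⟨x, hx⟩] at hcomm
  rw [← hright g]
  refine RegularWreathProduct.right_mem_zpowers_of_commute ht ?_
  simpa [f] using hcomm

/-- A nontrivial power of a free generator acts without nontrivial fixed points on the abelian
quotient of two consecutive terms of the derived series. -/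
theorem mem_closedDerivedSeries_of_commutator_mem (hX : IsFreeProSGroupOn S F X) (k : ℕ) {x : F}
    (hx : x ∈ X) {n : ℕ} (hn : n ≠ 0) {g : F} (hg : g ∈ closedDerivedSeries F (k + 1))
    (hgx : ⁅g, x ^ n⁆ ∈ closedDerivedSeries F (k + 2)) : g ∈ closedDerivedSeries F (k + 2) := by
  classical
  have := hX.isProSGroup.compactSpace
  have := hX.isProSGroup.totallyDisconnectedSpace
  refine (isClosed_closedDerivedSeries (k + 2)).mem_of_forall_openNormal fun N hN hNo => ?_
  have := hX.finite_quotient hNo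
  let H := closedDerivedSeries F (k + 1)
  let K' : Subgroup (F ⧸ N) := H.map (QuotientGroup.mk' N)
  have : K'.Normal := Subgroup.Normal.map inferInstance _ (QuotientGroup.mk'_surjective N)
  let K : Subgroup F := K'.comap (QuotientGroup.mk' N)
  have hHK : H ≤ K := Subgroup.le_comap_map _ _
  have hNK : N ≤ K := fun a ha => by
    rw [Subgroup.mem_comap, QuotientGroup.mk'_apply, (QuotientGroup.eq_one_iff a).2 ha]
    exact one_mem _
  have hKo : IsOpen (K : Set F) := Subgroup.isOpen_mono hNK hNo
  have := hX.finite_quotient hKo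
  let D := Abelianization K'
  have : Finite D := inferInstanceAs (Finite (K' ⧸ commutator K'))
  let θ : K →* D := Abelianization.of.comp ((QuotientGroup.mk' N).subgroupComap K')
  -- `K'` is the image of `H`, so an element of its commutator subgroup lifts to `⁅H, H⁆` modulo
  -- `N`.
  suffices hθ : θ ⟨g, hHK hg⟩ = 1 by
    have h1 : (⟨(g : F ⧸ N), hHK hg⟩ : K') ∈ commutator K' := by
      rw [← Abelianization.ker_of]
      exact hθ
    have h2 := Subgroup.mem_map_of_mem K'.subtype h1
    rw [Subgroup.map_subtype_commutator, ← Subgroup.map_commutator] at h2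
    obtain ⟨z, hz, hzg⟩ := h2
    exact ⟨z, Subgroup.le_topologicalClosure _ hz, QuotientGroup.eq.1 hzg⟩
  obtain ⟨φ, hφright, hφθ, hφN⟩ := exists_hom_regularWreathProduct K θ
  have hφo : IsOpen (φ.ker : Set F) := by
    refine Subgroup.isOpen_mono (hφN N hN hNK fun a ha => ?_) hNo
    have : (QuotientGroup.mk' N).subgroupComap K' a = 1 :=
      Subtype.ext ((QuotientGroup.eq_one_iff _).2 ha)
    rw [MonoidHom.comp_apply, this, map_one]
  apply hφθ
  let Q := F ⧸ K
  let e := Nat.card D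
  have he : e ≠ 0 := Nat.card_pos.ne'
  have hQ0 : n * Nat.card Q ≠ 0 := mul_ne_zero hn Nat.card_pos.ne'
  have : NeZero (e ^ (n * Nat.card Q + 1)) := ⟨pow_ne_zero _ he⟩
  let C := Multiplicative (ZMod (e ^ (n * Nat.card Q + 1)))
  have hC : Nat.card C = e ^ (n * Nat.card Q + 1) := Nat.card_zmod _
  let t : C := Multiplicative.ofAdd 1
  have ht : orderOf t = e ^ (n * Nat.card Q + 1) := by
    rw [orderOf_ofAdd_eq_addOrderOf, ZMod.addOrderOf_one]
  have hS : ∀ r : Nat.Primes, (r : ℕ) ∣ Nat.card (F ⧸ N) → r ∈ S :=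
    hX.isProSGroup.mem_of_dvd_index N hN hNo
  have hQN : Nat.card Q ∣ Nat.card (F ⧸ N) := Subgroup.index_dvd_of_le hNK
  have hDN : e ∣ Nat.card (F ⧸ N) :=
    (Subgroup.card_quotient_dvd_card (commutator K')).trans (Subgroup.card_subgroup_dvd_card K')
  -- The base of `φ y` is placed over `1 ∈ C`, so multiplying along `C` recovers `φ`; only `x` moves
  -- in the `C` direction.
  let f : X → D ≀ᵣ (Q × C) := fun y =>
    ⟨fun q => if q.2 = 1 then (φ y).left q.1 else 1, ((y : F), if (y : F) = x then t else 1)⟩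
  obtain ⟨ψ, hψo, hψ⟩ := hX.exists_hom_finite (W := D ≀ᵣ (Q × C)) (fun r hr => by
    rw [RegularWreathProduct.card, Nat.card_prod, hC, r.2.dvd_mul, r.2.dvd_mul] at hr
    rcases hr with hr | hr | hr
    · exact hS r ((r.2.dvd_of_dvd_pow hr).trans hDN)
    · exact hS r (hr.trans hQN)
    · exact hS r ((r.2.dvd_of_dvd_pow hr).trans hDN)) f (by
    refine ((hX.finite_setOf_notMem hφo).union (Set.finite_singleton ⟨x, hx⟩)).subset ?_
    intro y hy
    by_contra hy'
    simp only [Set.mem_union, Set.mem_ofPred_eq, Set.mem_singleton_iff, not_or, not_not,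
      MonoidHom.mem_ker] at hy'
    have h2 : (y : F) ≠ x := fun h => hy'.2 (Subtype.ext h)
    have h3 : ((y : F) : Q) = 1 := by rw [← hφright, hy'.1]; rfl
    apply hy
    ext q
    · simp [f, hy'.1]
    · exact h3
    · simp [f, h2])
  have hprod : (RegularWreathProduct.prodSnd D Q C).comp ψ = φ := by
    refine hX.hom_ext (MonoidHom.isOpen_ker_comp hψo _) hφo fun y => ?_
    rw [MonoidHom.comp_apply, hψ]
    ext q
    · exact Fintype.prod_ite_eq' (1 : C) fun _ => (φ y).left q
    · exact (hφright y).symm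
  have hfst : ∀ a : F, (ψ a).right.1 = a := fun a => by
    rw [← hφright, ← hprod]
    rfl
  have hsnd : ∀ a ∈ H, (ψ a).right.2 = 1 := fun a ha => by
    have hle := closedDerivedSeries_succ_le_ker
      (φ := ((MonoidHom.snd Q C).comp RegularWreathProduct.rightHom).comp ψ)
      (MonoidHom.isOpen_ker_comp hψo _) 0 fun _ _ _ _ => mul_comm _ _
    exact hle (closedDerivedSeries_antitone (by omega) ha)
  have hright : ∀ a ∈ H, (ψ a).right = 1 := fun a ha =>
    Prod.ext ((hfst a).trans ((QuotientGroup.eq_one_iff a).2 (hHK ha))) (hsnd a ha)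
  have hker : closedDerivedSeries F (k + 2) ≤ ψ.ker :=
    closedDerivedSeries_succ_le_ker hψo (k + 1) fun a ha b hb =>
      RegularWreathProduct.mul_comm_of_right_eq_one (hright a ha) (hright b hb)
  -- The extra power `|Q|` kills the `Q` component of `x ^ n`, leaving a pure translation along `C`.
  have hcomm := (MonoidHom.commute_of_commutator_mem hker hgx).pow_right (Nat.card Q)
  rw [map_pow, ← pow_mul, hψ ⟨x, hx⟩] at hcomm
  change φ g = 1
  rw [← hprod]
  refine RegularWreathProduct.prodSnd_eq_one_of_commute (hright g hg) hcomm
    (z := t ^ (n * Nat.card Q)) ?_ fun d => ?_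
  · rw [← RegularWreathProduct.rightHom_eq_right, map_pow, RegularWreathProduct.rightHom_eq_right]
    refine Prod.ext ?_ ?_
    · simp [f, pow_mul, Q]
    · simp [f]
  · obtain ⟨c, hc⟩ := dvd_orderOf_pow t he hQ0 ht
    rw [hc, pow_mul, pow_card_eq_one', one_pow]

end IsFreeProSGroupOn

/-! ### Centralizers and the center -/

namespace IsFreeProSGroupOn

open scoped Pointwise

variable {S : Set Nat.Primes} {F : Type u} [Group F] [TopologicalSpace F] [IsTopologicalGroup F]
  {X : Set F}

theorem exists_mem_closure_zpowers (hX : IsFreeProSGroupOn S F X) (k : ℕ) {x : F} (hx : x ∈ X)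
    {n : ℕ} (hn : n ≠ 0) {g : F} (hg : ⁅g, x ^ n⁆ ∈ closedDerivedSeries F (k + 2)) :
    ∃ z ∈ (Subgroup.zpowers x).topologicalClosure, z⁻¹ * g ∈ closedDerivedSeries F (k + 2) := by
  have := hX.isProSGroup.compactSpace
  have := hX.isProSGroup.totallyDisconnectedSpace
  have := hX.isProSGroup.t2Space
  have hZ : IsClosed (((Subgroup.zpowers x).topologicalClosure : Set F) *
      (closedDerivedSeries F (k + 1) : Set F)) :=
    ((Subgroup.isClosed_topologicalClosure _).isCompact.mul
      (isClosed_closedDerivedSeries _).isCompact).isClosed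
  obtain ⟨z, hz, h, hh, rfl⟩ := hZ.mem_of_forall_openNormal (g := g) fun N hN hNo => by
    obtain ⟨j, hj⟩ := hX.mk_mem_zpowers_of_commutator_mem (k + 1)
      (K := closedDerivedSeries F (k + 1) ⊔ N) (Subgroup.isOpen_mono le_sup_right hNo)
      le_sup_left hx hn hg
    change ((x ^ j : F) : F ⧸ closedDerivedSeries F (k + 1) ⊔ N) = (g : F ⧸ _) at hj
    obtain ⟨y, hy, ν, hν, h⟩ := Subgroup.mem_sup_of_normal_right.1 (QuotientGroup.eq.1 hj)
    refine ⟨x ^ j * y, Set.mul_mem_mul (Subgroup.le_topologicalClosure _ ⟨j, rfl⟩) hy, ?_⟩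
    rw [mul_inv_rev, mul_assoc, ← h, inv_mul_cancel_left]
    exact hν
  refine ⟨z, hz, ?_⟩
  have hzx : Commute z (x ^ n) := by
    have hle : (Subgroup.zpowers x).topologicalClosure ≤ Subgroup.centralizer {x ^ n} :=
      Subgroup.topologicalClosure_minimal _
        (by simp [Subgroup.zpowers_le, Subgroup.mem_centralizer_singleton_iff, pow_mul_comm'])
        (Set.isClosed_centralizer _)
    exact Subgroup.mem_centralizer_singleton_iff.1 (hle hz)
  have hhx : ⁅h, x ^ n⁆ ∈ closedDerivedSeries F (k + 2) := by
    have h1 := (closedDerivedSeries_normal F (k + 2)).conj_mem _ hg z⁻¹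
    have h2 : z⁻¹ * ⁅z * h, x ^ n⁆ * z⁻¹⁻¹ = ⁅h, x ^ n⁆ := by
      simp only [commutatorElement_def, mul_inv_rev, inv_inv, mul_assoc, inv_mul_cancel_left]
      rw [← mul_assoc z⁻¹, hzx.inv_inv.eq, inv_mul_cancel_right]
    rwa [h2] at h1
  change z⁻¹ * (z * h) ∈ _
  rw [inv_mul_cancel_left]
  exact hX.mem_closedDerivedSeries_of_commutator_mem k hx hn hh hhx

theorem centralizer_mk_zpow (hX : IsFreeProSGroupOn S F X) (k : ℕ) {x : F} (hx : x ∈ X)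
    {n : ℤ} (hn : n ≠ 0) :
    Subgroup.centralizer {((x ^ n : F) : MStepSolvableQuotient F (k + 2))} =
      (Subgroup.zpowers (x : MStepSolvableQuotient F (k + 2))).topologicalClosure := by
  have : IsClosed (closedDerivedSeries F (k + 2) : Set F) := isClosed_closedDerivedSeries _
  apply le_antisymm
  · intro q hq
    induction q using QuotientGroup.induction_on with
    | H g =>
    rw [Subgroup.mem_centralizer_singleton_iff] at hq
    have hcomm : Commute (g : MStepSolvableQuotient F (k + 2)) ((x ^ n.natAbs : F)) := by
      rw [QuotientGroup.mk_zpow] at hq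
      rw [QuotientGroup.mk_pow]
      have hq' : Commute (g : MStepSolvableQuotient F (k + 2)) (x ^ n) := hq
      rcases Int.natAbs_eq n with h | h
      · rwa [h, zpow_natCast] at hq'
      · rwa [h, zpow_neg, zpow_natCast, Commute.inv_right_iff] at hq'
    rw [← commutatorElement_eq_one_iff_commute] at hcomm
    obtain ⟨z, hz, hzg⟩ := hX.exists_mem_closure_zpowers k hx (Int.natAbs_ne_zero.2 hn)
      ((QuotientGroup.eq_one_iff (N := closedDerivedSeries F (k + 2)) _).1 hcomm)
    rw [← QuotientGroup.eq.2 hzg]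
    refine map_mem_closure QuotientGroup.continuous_mk hz ?_
    rintro _ ⟨j, rfl⟩
    exact ⟨j, (QuotientGroup.mk_zpow _ _ _).symm⟩
  · refine Subgroup.topologicalClosure_minimal _ ?_ (Set.isClosed_centralizer _)
    rw [Subgroup.zpowers_le, Subgroup.mem_centralizer_singleton_iff, QuotientGroup.mk_zpow]
    exact (Commute.refl _).zpow_right n

theorem mul_comm_of_subsingleton (hX : IsFreeProSGroupOn S F X) (hs : X.Subsingleton) (a b : F) :
    a * b = b * a := by
  have := hX.isProSGroup.t2Space
  have h1 : Subgroup.centralizer X = ⊤ :=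
    hX.eq_top_of_isClosed (Set.isClosed_centralizer _) fun x hx y hy => by rw [hs hx hy]
  have h2 : Subgroup.centralizer (Set.univ : Set F) = ⊤ :=
    hX.eq_top_of_isClosed (Set.isClosed_centralizer _) fun x hx y _ =>
      ((h1 ▸ Subgroup.mem_top y : y ∈ Subgroup.centralizer X) x hx).symm
  exact (h2 ▸ Subgroup.mem_top b : b ∈ Subgroup.centralizer (Set.univ : Set F)) a (Set.mem_univ a)

/-- The closed subgroups generated by two distinct free generators intersect trivially. -/
theorem mem_of_mem_closure_zpowers (hX : IsFreeProSGroupOn S F X) (m : ℕ) {x y : F} (hx : x ∈ X)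
    (hy : y ∈ X) (hxy : x ≠ y) {q : MStepSolvableQuotient F (m + 1)}
    (hqx : q ∈ (Subgroup.zpowers (x : MStepSolvableQuotient F (m + 1))).topologicalClosure)
    (hqy : q ∈ (Subgroup.zpowers (y : MStepSolvableQuotient F (m + 1))).topologicalClosure) :
    q = 1 := by
  classical
  have : IsClosed (closedDerivedSeries F (m + 1) : Set F) := isClosed_closedDerivedSeries _
  -- The endomorphism `ρ` fixes `x` and kills every other generator: it is the identity on one
  -- closed subgroup and trivial on the other.
  obtain ⟨ρ, hρ, -⟩ := hX.existsUnique_extension F hX.isProSGroup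
    (fun z => if (z : F) = x then x else 1) <| by
      refine tendsto_nhds_of_eventually_eq ?_
      rw [eventually_cofinite]
      refine (Set.finite_singleton (⟨x, hx⟩ : X)).subset fun z hz => ?_
      by_contra hzx
      exact hz (if_neg fun h => hzx (Subtype.ext h))
  let r : MStepSolvableQuotient F (m + 1) →* MStepSolvableQuotient F (m + 1) :=
    QuotientGroup.map _ _ ρ.toMonoidHom (map_closedDerivedSeries_le _ ρ.continuous_toFun _)
  have hr : Continuous r :=
    (QuotientGroup.continuous_mk.comp ρ.continuous_toFun).quotient_lift _
  have hrx : r x = x := congrArg QuotientGroup.mk ((hρ ⟨x, hx⟩).trans (if_pos rfl))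
  have hry : r y = 1 := congrArg QuotientGroup.mk ((hρ ⟨y, hy⟩).trans (if_neg hxy.symm))
  have h1 : (Subgroup.zpowers (x : MStepSolvableQuotient F (m + 1))).topologicalClosure ≤
      r.eqLocus (MonoidHom.id _) :=
    Subgroup.topologicalClosure_minimal _ (by rw [Subgroup.zpowers_le]; exact hrx)
      (isClosed_eq hr continuous_id)
  have h2 : (Subgroup.zpowers (y : MStepSolvableQuotient F (m + 1))).topologicalClosure ≤ r.ker :=
    Subgroup.topologicalClosure_minimal _ (by rw [Subgroup.zpowers_le]; exact hry)
      (isClosed_singleton.preimage hr)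
  exact (h1 hqx : r q = q).symm.trans (h2 hqy)

end IsFreeProSGroupOn

theorem mainTheorem6 (S : Set Nat.Primes) {F : Type u} [Group F] [TopologicalSpace F]
    [IsTopologicalGroup F] (X : Set F) (hX : IsFreeProSGroupOn S F X) (m : ℕ) (hm : 2 ≤ m) :
    (∀ x ∈ X, ∀ n : ℤ, n ≠ 0 →
      Subgroup.centralizer {((x ^ n : F) : MStepSolvableQuotient F m)} =
        (Subgroup.zpowers (x : MStepSolvableQuotient F m)).topologicalClosure) ∧
    ((∀ a b : MStepSolvableQuotient F m, a * b = b * a) ∨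
      Subgroup.center (MStepSolvableQuotient F m) = ⊥) := by
  obtain ⟨k, rfl⟩ := Nat.exists_eq_add_of_le' hm
  refine ⟨fun x hx n hn => hX.centralizer_mk_zpow k hx hn, ?_⟩
  by_cases hs : X.Subsingleton
  · left
    intro a b
    induction a using QuotientGroup.induction_on with
    | H a =>
    induction b using QuotientGroup.induction_on with
    | H b => exact congrArg QuotientGroup.mk (hX.mul_comm_of_subsingleton hs a b)
  · right
    obtain ⟨x, hx, y, hy, hxy⟩ := Set.not_subsingleton_iff.1 hs
    rw [eq_bot_iff]
    intro q hq
    have hmem : ∀ z ∈ X,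
        q ∈ (Subgroup.zpowers (z : MStepSolvableQuotient F (k + 2))).topologicalClosure :=
      fun z hz => by
        rw [← hX.centralizer_mk_zpow k hz one_ne_zero]
        exact Subgroup.center_le_centralizer _ hq
    exact hX.mem_of_mem_closure_zpowers (k + 1) hx hy hxy (hmem x hx) (hmem y hy)
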